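/- Let $K=\mathbb{F}_q$ be a finite field, let $s\ge 1$, and let $y^{v_1},\ldots,y^{v_s}$ be monomials in $K[y_1,\ldots,y_n]$ of clutter type: writing $\operatorname{supp}(y^{v_i})$ for the set of variables that occur in $y^{v_i}$, one has $\operatorname{supp}(y^{v_i})\not\subseteq\operatorname{supp}(y^{v_j})$ for all $i\ne j$. Let $\mathbb{X}\subset\mathbb{P}^{s-1}$ be the set, over $K$, parameterized by these monomials, i.e. the set of all points $[(x^{v_1},\ldots,x^{v_s})]$ with $x\in K^n$ and $x^{v_i}\neq 0$ for some $i$. Let $I(\mathbb{X})\subset S=K[t_1,\ldots,t_s]$ be its vanishing ideal, i.e. the ideal generated by the homogeneous polynomials that vanish at all points of $\mathbb{X}$. An ideal $I\subset S$ is called a complete intersection if $I=(g_1,\ldots,g_r)$ for some $g_1,\ldots,g_r\in S$, where $r$ is the height of $I$. Then $I(\mathbb{X})$ is a complete intersection if and only if $s\le 4$ and, up to a permutation of the variables $t_1,\ldots,t_s$, $I(\mathbb{X})$ has one of the following forms: (i) $s=4$, $q$ is odd and $I(\mathbb{X})=(t_1t_2-t_3t_4,\ t_1t_3-t_2t_4,\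 t_2t_3-t_1t_4)$; (ii) $s=3$ and $I(\mathbb{X})=(t_1t_2-t_2t_3,\ t_1t_3-t_2t_3)$; (iii) $s=2$ and $I(\mathbb{X})=(t_1^{r+1}t_2-t_1t_2^{r+1})$ for some integer $r\geq 1$ dividing $q-1$; (iv) $s=1$ and $I(\mathbb{X})=(0)$. -/

import Mathlib

open scoped LinearAlgebra.Projectivization
open MvPolynomial (X)

/-- The monomial `y^a = y_1^{a_1} ⋯ y_n^{a_n}` evaluated at a point `x` of `K^n`. -/
def monomialValue {K : Type*} [Field K] {n : ℕ} (a : Fin n →₀ ℕ) (x : Fin n → K) : K :=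
  ∏ k, x k ^ a k

/-- The subset of `ℙ^{s-1}` parameterized by the monomials `y^{v_1}, …, y^{v_s}`: all points
`[(x^{v_1}, …, x^{v_s})]` with `x ∈ K^n` that are well defined, i.e. `x^{v_i} ≠ 0` for some `i`. -/
def parameterizedSet (K : Type*) [Field K] {s n : ℕ} (v : Fin s → (Fin n →₀ ℕ)) :
    Set (ℙ K (Fin s → K)) :=
  {P | ∃ (x : Fin n → K) (h : (fun i => monomialValue (v i) x) ≠ 0),
    P = Projectivization.mk K (fun i => monomialValue (v i) x) h}

/-- The monomials `y^{v_1}, …, y^{v_s}` are of clutter type: no support (the set of variables that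
occur in the monomial) is contained in another one. -/
def IsClutterType {s n : ℕ} (v : Fin s → (Fin n →₀ ℕ)) : Prop :=
  ∀ i j, i ≠ j → ¬ (v i).support ⊆ (v j).support

/-- A polynomial vanishes at a projective point if it is zero at all homogeneous coordinate vectors
of the point (for a homogeneous polynomial, one vector suffices). -/
def VanishesAt {K : Type*} [Field K] {s : ℕ} (f : MvPolynomial (Fin s) K)
    (P : ℙ K (Fin s → K)) : Prop :=
  ∀ (w : Fin s → K) (hw : w ≠ 0), Projectivization.mk K w hw = P → MvPolynomial.eval w f = 0

/-- The vanishing ideal `I(Y)` of `Y ⊆ ℙ^{s-1}`: the ideal of `K[t_1, …, t_s]` generated by the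
homogeneous polynomials that vanish at all points of `Y`. -/
noncomputable def projVanishingIdeal {K : Type*} [Field K] {s : ℕ} (Y : Set (ℙ K (Fin s → K))) :
    Ideal (MvPolynomial (Fin s) K) :=
  Ideal.span {f | (∃ d : ℕ, f.IsHomogeneous d) ∧ ∀ P ∈ Y, VanishesAt f P}

/-- An ideal is a complete intersection if it is generated by `r` elements, where `r` is its
height. -/
def IsCompleteIntersection {A : Type*} [CommRing A] (I : Ideal A) : Prop :=
  ∃ (r : ℕ) (g : Fin r → A), I = Ideal.span (Set.range g) ∧ I.height = (r : ℕ∞)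

/-!
Write `q` for the number of elements of `K` and `I` for the vanishing ideal. Because of the clutter
condition, all coordinate points belong to the parameterized set; so does the point with all
coordinates `1`.

* `height_projVanishingIdeal`: `I` has height `s - 1`. It lies in the ideal of a coordinate point,
  and it contains the polynomials `t_k t_i ^ q - t_k ^ q t_i`, which force every prime over `I` to
  contain `s - 1` independent linear forms. So `I` is a complete intersection if and only if it is
  generated by `s - 1` elements, which gives one direction of the theorem.
* `span_vanishingBinomials`: `I` is generated by homogeneous binomials `t^a - t^b`, by the linear
  independence of the characters of the monoid `K^n`.
* `exists_binomial_generators`: if `I` is generated by `s - 1` elements, then by the graded Nakayama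
  lemma (`exists_generators_subset_of_homogeneous`) it is generated by at most `s - 1` of these
  binomials. The polynomials `t_k t_i ^ q - t_k ^ q t_i` show that the gradients of the generators
  at the `i`-th coordinate point, restricted to the directions `t_k` with `k ≠ i`, span a space of
  dimension `s - 1`. Hence there are exactly `s - 1` generators, and none of their gradients at a
  coordinate point is zero.
* `exists_shape_of_coordinateGradient_ne_zero`: the gradient of `t^a - t^b` at the `i`-th coordinate
  point is nonzero only if one of its two monomials is `t_k t_i ^ d` with `k ≠ i`. For `d ≥ 2` a
  monomial has this shape for one `i` only, so that `s ≤ 2`; for `d = 1` it has it for two, so that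
  `s ≤ 4` and the binomial is `t_k t_i - t_l t_j` with all variables among these four.

For `s = 4` and `s = 3`, these binomials span spaces of dimension at most `3` and `2`, and linear
independence of the `s - 1` generators shows that they span everything. For `s = 4` the
characteristic is not two, because in characteristic two the resulting ideal is not radical. For
`s = 2` the one generator is `t_1 ^ (r + 1) t_2 - t_1 t_2 ^ (r + 1)` up to sign, and it divides
`t_1 t_2 ^ q - t_1 ^ q t_2`, which implies that `r` divides `q - 1`.
-/

/-! ### Heights of ideals of polynomials over a finite field -/

open MvPolynomial in
/-- A prime containing `t_k - c_k t_i` for all `k` in a finite set `T` that omits `i` has height at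
least `|T|`: below it lies the chain of kernels of the substitutions `t_k ↦ c_k t_i`, made for one
more `k ∈ T` at each step. -/
theorem card_le_height_of_sub_mem {K σ : Type*} [Field K] (i : σ) (c : σ → K) (T : Finset σ)
    (hT : i ∉ T) (P : Ideal (MvPolynomial σ K)) [P.IsPrime]
    (hP : ∀ k ∈ T, X k - C (c k) * X i ∈ P) : (T.card : ℕ∞) ≤ P.height := by
  classical
  let φ : Finset σ → MvPolynomial σ K →ₐ[K] MvPolynomial σ K :=
    fun T => aeval fun k => if k ∈ T then C (c k) * X i else X k
  have hker : ∀ T : Finset σ, i ∉ T → (T.card : ℕ∞) ≤ (RingHom.ker (φ T)).height := by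
    intro T
    induction T using Finset.induction_on with
    | empty => simp
    | insert k T hk ih =>
      intro hi
      rw [Finset.mem_insert, not_or] at hi
      have hcomp : φ (insert k T) = (φ (insert k T)).comp (φ T) := by
        refine algHom_ext fun l => ?_
        by_cases hl : l ∈ T
        · simp [φ, hl, hi.1, hi.2]
        · simp [φ, hl]
      have hlt : RingHom.ker (φ T) < RingHom.ker (φ (insert k T)) := by
        refine lt_of_le_of_ne (fun f hf => ?_) fun h => ?_
        · rw [RingHom.mem_ker] at hf ⊢
          rw [hcomp, AlgHom.comp_apply, hf, map_zero]
        · have h1 : X k - C (c k) * X i ∈ RingHom.ker (φ (insert k T)) := by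
            simp [RingHom.mem_ker, φ, hi.1, hi.2]
          rw [← h, RingHom.mem_ker] at h1
          have h2 : (X k - C (c k) * X i : MvPolynomial σ K) = 0 := by
            simpa [φ, hk, hi.2] using h1
          have h3 := congrArg (eval (Pi.single k (1 : K))) h2
          simp [hi.1] at h3
      have := RingHom.ker_isPrime (φ T)
      have := RingHom.ker_isPrime (φ (insert k T))
      rw [Finset.card_insert_of_notMem hk]
      push_cast
      exact (add_le_add_left (ih hi.2) 1).trans (Ideal.height_add_one_le_of_lt_of_isPrime hlt)
  refine (hker T hT).trans (Ideal.height_mono fun f hf => ?_)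
  have hmk : (Ideal.Quotient.mkₐ K P).comp (φ T) = Ideal.Quotient.mkₐ K P := by
    refine algHom_ext fun l => ?_
    by_cases hl : l ∈ T
    · simpa [φ, hl] using (Ideal.Quotient.eq.2 (hP l hl)).symm
    · simp [φ, hl]
  have h1 := DFunLike.congr_fun hmk f
  rw [AlgHom.comp_apply, (RingHom.mem_ker).1 hf, map_zero] at h1
  exact Ideal.Quotient.eq_zero_iff_mem.1 h1.symm

/-- In a field extension of a finite field `K` with `q` elements, the solutions of `z ^ q = z` are
the elements of `K`. -/
theorem exists_algebraMap_eq_of_pow_card_eq {K L : Type*} [Field K] [Fintype K] [Field L]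
    [Algebra K L] {z : L} (hz : z ^ Fintype.card K = z) : ∃ c : K, z = algebraMap K L c := by
  classical
  have hq : 1 < Fintype.card K := Fintype.one_lt_card
  have hprod := Polynomial.prod_multiset_X_sub_C_of_monic_of_roots_card_eq
    (p := (Polynomial.X ^ Fintype.card K - Polynomial.X : Polynomial K))
    (Polynomial.monic_X_pow_sub (by rw [Polynomial.degree_X]; exact_mod_cast hq))
    (by rw [FiniteField.roots_X_pow_card_sub_X, FiniteField.X_pow_card_sub_X_natDegree_eq K hq]
        rfl)
  rw [FiniteField.roots_X_pow_card_sub_X] at hprod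
  have h0 : ∏ c : K, (z - algebraMap K L c) = 0 := by
    have h := congrArg (Polynomial.aeval z) hprod
    rw [map_sub, map_pow, Polynomial.aeval_X, hz, sub_self, map_multiset_prod,
      Multiset.map_map] at h
    change ∏ c : K, Polynomial.aeval z (Polynomial.X - Polynomial.C c) = 0 at h
    simpa only [map_sub, Polynomial.aeval_X, Polynomial.aeval_C] using h
  obtain ⟨c, -, hc⟩ := Finset.prod_eq_zero_iff.1 h0
  exact ⟨c, sub_eq_zero.1 hc⟩

/-- If the polynomials `t_k t_i ^ q - t_k ^ q t_i` all lie in an ideal `I` of the polynomial ring in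
`s` variables over a field with `q` elements, then `I` has height at least `s - 1`: a prime over `I`
contains either all variables, or `t_k - c_k t_i` for all `k` and some `i`, `c`. -/
theorem card_sub_one_le_height {K σ : Type*} [Field K] [Fintype K] [Fintype σ]
    (I : Ideal (MvPolynomial σ K))
    (hI : ∀ i k, X k * X i ^ Fintype.card K - X k ^ Fintype.card K * X i ∈ I) :
    ((Fintype.card σ - 1 : ℕ) : ℕ∞) ≤ I.height := by
  classical
  rw [Ideal.height_eq_inf_minimalPrimes]
  refine le_iInf₂ fun P hP => ?_
  have hprime : P.IsPrime := hP.1.1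
  rcases isEmpty_or_nonempty σ with hσ | ⟨⟨i₀⟩⟩
  · simp
  obtain ⟨i, c, hc⟩ : ∃ (i : σ) (c : σ → K), ∀ k, X k - MvPolynomial.C (c k) * X i ∈ P := by
    by_cases hall : ∀ i, (X i : MvPolynomial σ K) ∈ P
    · exact ⟨i₀, 0, fun k => by simpa using hall k⟩
    push Not at hall
    obtain ⟨i, hi⟩ := hall
    let L := FractionRing (MvPolynomial σ K ⧸ P)
    let ψ : MvPolynomial σ K →ₐ[K] L :=
      (IsScalarTower.toAlgHom K (MvPolynomial σ K ⧸ P) L).comp (Ideal.Quotient.mkₐ K P)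
    have hψ : ∀ f, ψ f = 0 ↔ f ∈ P := fun f => by
      simp [ψ, Ideal.Quotient.eq_zero_iff_mem]
    have hi0 : ψ (X i) ≠ 0 := fun h => hi ((hψ _).1 h)
    have hc : ∀ k, ∃ c : K, ψ (X k) / ψ (X i) = algebraMap K L c := fun k => by
      apply exists_algebraMap_eq_of_pow_card_eq
      have h := (hψ _).2 (hP.1.2 (hI i k))
      rw [map_sub, map_mul, map_mul, map_pow, map_pow, sub_eq_zero] at h
      rw [div_pow, div_eq_div_iff (pow_ne_zero _ hi0) hi0, h]
    choose c hc using hc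
    refine ⟨i, c, fun k => (hψ _).1 ?_⟩
    rw [map_sub, map_mul, (div_eq_iff hi0).1 (hc k), MvPolynomial.algHom_C, sub_self]
  have h := card_le_height_of_sub_mem i c (Finset.univ.erase i) (by simp) P fun k _ => hc k
  rwa [Finset.card_erase_of_mem (Finset.mem_univ i), Finset.card_univ] at h

/-- An ideal inside the ideal of the `i`-th coordinate point, which is generated by the variables
other than `t_i`, has height at most the number of these variables. -/
theorem height_le_card_sub_one {K σ : Type*} [Field K] [Fintype σ] (i : σ)
    (I : Ideal (MvPolynomial σ K))
    (hI : I ≤ Ideal.span (X '' {k : σ | k ≠ i})) :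
    I.height ≤ ((Fintype.card σ - 1 : ℕ) : ℕ∞) := by
  classical
  refine (Ideal.height_mono hI).trans ((Ideal.height_le_spanFinrank _ fun h => ?_).trans ?_)
  · have h1 := MvPolynomial.mem_ideal_span_X_image.1 ((Ideal.eq_top_iff_one _).1 h) 0
    simp at h1
  · refine Nat.cast_le.2 ((Submodule.spanFinrank_span_le_ncard_of_finite (Set.toFinite _)).trans
      ((Set.ncard_image_le (Set.toFinite _)).trans (le_of_eq ?_)))
    rw [Set.ncard_eq_toFinset_card']
    simp [Finset.filter_ne', Finset.card_erase_of_mem]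

/-! ### Homogeneous generators -/

/-- Graded Nakayama lemma, in the form used to choose generators: if an ideal spanned by a set `B`
of homogeneous polynomials is generated by `r` polynomials, then it is generated by at most `r`
elements of `B`. They are lifted from a basis of `I / 𝔪 I` taken from the image of `B`. -/
theorem exists_generators_subset_of_homogeneous {K σ : Type*} [Field K]
    (B : Set (MvPolynomial σ K)) (hB : ∀ f ∈ B, ∃ d, f.IsHomogeneous d)
    {r : ℕ} (f : Fin r → MvPolynomial σ K) (hf : Ideal.span B = Ideal.span (Set.range f)) :
    ∃ (m : ℕ) (g : Fin m → MvPolynomial σ K), m ≤ r ∧ (∀ j, g j ∈ B) ∧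
      Ideal.span B = Ideal.span (Set.range g) := by
  classical
  set I := Ideal.span B with hI
  let 𝔪 : Ideal (MvPolynomial σ K) := RingHom.ker MvPolynomial.constantCoeff
  let N : Submodule K (MvPolynomial σ K) := (𝔪 * I).restrictScalars K
  have hspan : ∀ T : Set (MvPolynomial σ K), T ⊆ I → ∀ h ∈ Ideal.span T,
      N.mkQ h ∈ Submodule.span K (N.mkQ '' T) := by
    intro T hT h hh
    have hTI : Ideal.span T ≤ I := Ideal.span_le.2 hT
    induction hh using Submodule.span_induction with
    | mem x hx => exact Submodule.subset_span ⟨x, hx, rfl⟩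
    | zero => simp
    | add x y _ _ hx hy => rw [map_add]; exact add_mem hx hy
    | smul p x hx' hx =>
      have : N.mkQ (p • x) = MvPolynomial.constantCoeff p • N.mkQ x := by
        rw [← map_smul, ← sub_eq_zero, ← map_sub, Submodule.mkQ_apply,
          Submodule.Quotient.mk_eq_zero]
        have : p • x - MvPolynomial.constantCoeff p • x
            = (p - MvPolynomial.C (MvPolynomial.constantCoeff p)) * x := by
          rw [smul_eq_mul, MvPolynomial.smul_eq_C_mul, sub_mul]
        rw [this]
        exact Ideal.mul_mem_mul (by simp [𝔪, RingHom.mem_ker]) (hTI hx')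
      rw [this]
      exact Submodule.smul_mem _ _ hx
  have hBI : B ⊆ I := Ideal.subset_span
  have hfI : Set.range f ⊆ I := by rw [hf]; exact Ideal.subset_span
  obtain ⟨b, hbB, hbspan, hbind⟩ := exists_linearIndependent K (N.mkQ '' B)
  have hbf : Set.range ((↑) : b → MvPolynomial σ K ⧸ N)
      ≤ Submodule.span K (N.mkQ '' Set.range f) := by
    rw [Subtype.range_coe]
    intro x hx
    obtain ⟨y, hy, rfl⟩ := hbB hx
    exact hspan _ hfI y (hf ▸ hBI hy)
  have hfin : Finite b := hbind.finite_of_le_span_finite _ _ hbf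
  have := Fintype.ofFinite b
  have hcard : Fintype.card b ≤ r := by
    refine (linearIndependent_le_span_aux' _ hbind _ hbf).trans ?_
    rw [← Set.toFinset_card]
    refine le_trans (Finset.card_le_card (t := Finset.univ.image (N.mkQ ∘ f)) ?_)
      (Finset.card_image_le.trans (by simp))
    intro x
    simp
  choose lift hliftB hlift using fun x : b => hbB x.2
  refine ⟨Fintype.card b, lift ∘ (Fintype.equivFin b).symm, hcard, fun j => hliftB _, ?_⟩
  rw [EquivLike.range_comp]
  set J := Ideal.span (Set.range lift) with hJ
  have hJI : J ≤ I := Ideal.span_le.2 (by rintro _ ⟨x, rfl⟩; exact hBI (hliftB x))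
  let := MvPolynomial.gradedAlgebra (σ := σ) (R := K)
  have hhomJ : J.IsHomogeneous (MvPolynomial.homogeneousSubmodule σ K) :=
    Ideal.homogeneous_span _ _ fun x hx => by
      obtain ⟨y, rfl⟩ := hx
      exact (hB _ (hliftB y)).imp fun d hd => hd
  -- modulo `𝔪 I`, every element of `I` is a linear combination of the chosen generators
  have hdecomp : ∀ h ∈ I, ∃ h' ∈ J, h - h' ∈ 𝔪 * I := by
    intro h hh
    have h1 := hspan B hBI h hh
    rw [← hbspan] at h1
    have h2 : Submodule.span K b ≤ (J.restrictScalars K).map N.mkQ := by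
      refine Submodule.span_le.2 fun x hx =>
        ⟨lift ⟨x, hx⟩, Ideal.subset_span ⟨_, rfl⟩, hlift ⟨x, hx⟩⟩
    obtain ⟨h', hh', he⟩ := h2 h1
    refine ⟨h', hh', ?_⟩
    have : N.mkQ (h - h') = 0 := by rw [map_sub, he, sub_self]
    rwa [Submodule.mkQ_apply, Submodule.Quotient.mk_eq_zero] at this
  have key : ∀ d, ∀ h ∈ I, MvPolynomial.homogeneousComponent d h ∈ J := by
    intro d
    induction d using Nat.strong_induction_on with
    | _ d ih =>
      intro h hh
      obtain ⟨h', hh', hn⟩ := hdecomp h hh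
      have h1 : MvPolynomial.homogeneousComponent d (h - h') ∈ J := by
        refine Submodule.mul_induction_on hn (fun p hp x hx => ?_) fun x y hx hy => by
          rw [map_add]; exact add_mem hx hy
        rw [← MvPolynomial.sum_homogeneousComponent p, ← MvPolynomial.sum_homogeneousComponent x,
          Finset.sum_mul_sum, map_sum]
        refine sum_mem fun i _ => ?_
        rw [map_sum]
        refine sum_mem fun e _ => ?_
        have hmem := (MvPolynomial.homogeneousComponent_isHomogeneous i p).mul
          (MvPolynomial.homogeneousComponent_isHomogeneous e x)
        rw [MvPolynomial.homogeneousComponent_of_mem hmem]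
        split_ifs with hd
        · rcases Nat.eq_zero_or_pos i with rfl | hi
          · have : MvPolynomial.coeff 0 p = 0 := hp
            rw [MvPolynomial.homogeneousComponent_zero, this]
            simp
          · exact J.mul_mem_left _ (ih e (by omega) x hx)
        · exact zero_mem _
      have h2 : MvPolynomial.homogeneousComponent d h' ∈ J :=
        MvPolynomial.homogeneousComponent_mem_of_mem hhomJ hh' d
      have := add_mem h1 h2
      rwa [← map_add, sub_add_cancel] at this
  refine le_antisymm (fun h hh => ?_) hJI
  rw [← MvPolynomial.sum_homogeneousComponent h]
  exact sum_mem fun d _ => key d h hh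

/-! ### The vanishing ideal of a parameterized set -/

/-- The affine point `(x^{v_1}, …, x^{v_s})`. -/
def monomialPoint {K : Type*} [Field K] {s n : ℕ} (v : Fin s → (Fin n →₀ ℕ)) (x : Fin n → K) :
    Fin s → K :=
  fun i => monomialValue (v i) x

theorem MvPolynomial.IsHomogeneous.eval_smul_eq {K σ : Type*} [Field K] {f : MvPolynomial σ K}
    {d : ℕ} (hf : f.IsHomogeneous d) (c : K) (w : σ → K) :
    MvPolynomial.eval (c • w) f = c ^ d * MvPolynomial.eval w f := by
  rw [MvPolynomial.eval_eq, MvPolynomial.eval_eq, Finset.mul_sum]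
  refine Finset.sum_congr rfl fun a ha => ?_
  have hd : a.degree = d := (hf.degree_eq_sum_deg_support ha).symm
  simp_rw [Pi.smul_apply, smul_eq_mul, mul_pow, Finset.prod_mul_distrib, Finset.prod_pow_eq_pow_sum]
  rw [← hd, Finsupp.degree_apply]
  ring


section

variable {K : Type*} [Field K] {s n : ℕ} {v : Fin s → (Fin n →₀ ℕ)}

theorem monomialPoint_one : monomialPoint v (1 : Fin n → K) = 1 := by
  ext i
  simp [monomialPoint, monomialValue]

/-- For a clutter, the indicator vector of the support of `y^{v_i}` parameterizes the `i`-th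
coordinate point. -/
theorem exists_monomialPoint_eq_single (hv : IsClutterType v) (i : Fin s) :
    ∃ x : Fin n → K, monomialPoint v x = Pi.single i 1 := by
  classical
  refine ⟨fun k => if k ∈ (v i).support then 1 else 0, ?_⟩
  ext j
  rcases eq_or_ne j i with rfl | hij
  · rw [Pi.single_eq_same]
    change ∏ k, (if k ∈ (v j).support then (1 : K) else 0) ^ v j k = 1
    refine Finset.prod_eq_one fun k _ => ?_
    by_cases hk : k ∈ (v j).support
    · simp [hk]
    · simp [Finsupp.notMem_support_iff.1 hk]
  · rw [Pi.single_eq_of_ne hij]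
    obtain ⟨k, hkj, hki⟩ := Finset.not_subset.1 (hv j i hij)
    exact Finset.prod_eq_zero (Finset.mem_univ k) (by
      simp only [if_neg hki]
      exact zero_pow (Finsupp.mem_support_iff.1 hkj))

/-- Whether a form vanishes at a projective point can be tested at the parameterizing vector. -/
theorem forall_vanishesAt_iff {f : MvPolynomial (Fin s) K} {d : ℕ} (hf : f.IsHomogeneous d) :
    (∀ P ∈ parameterizedSet K v, VanishesAt f P) ↔
      ∀ x : Fin n → K, monomialPoint v x ≠ 0 → MvPolynomial.eval (monomialPoint v x) f = 0 := by
  constructor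
  · intro h x hx
    exact h _ ⟨x, hx, rfl⟩ _ hx rfl
  · rintro h _ ⟨x, hx, rfl⟩ w hw hP
    obtain ⟨c, rfl⟩ := (Projectivization.mk_eq_mk_iff' K _ _ hw hx).1 hP
    exact (hf.eval_smul_eq c _).trans (mul_eq_zero_of_right _ (h x hx))

theorem mem_projVanishingIdeal {f : MvPolynomial (Fin s) K} {d : ℕ} (hf : f.IsHomogeneous d)
    (h : ∀ x : Fin n → K, MvPolynomial.eval (monomialPoint v x) f = 0) :
    f ∈ projVanishingIdeal (parameterizedSet K v) :=
  Ideal.subset_span ⟨⟨d, hf⟩, (forall_vanishesAt_iff hf).2 fun x _ => h x⟩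

theorem eval_eq_zero_of_mem_projVanishingIdeal {f : MvPolynomial (Fin s) K}
    (hf : f ∈ projVanishingIdeal (parameterizedSet K v)) {x : Fin n → K}
    (hx : monomialPoint v x ≠ 0) : MvPolynomial.eval (monomialPoint v x) f = 0 := by
  have hle : projVanishingIdeal (parameterizedSet K v)
      ≤ RingHom.ker (MvPolynomial.eval (monomialPoint v x)) := by
    refine Ideal.span_le.2 ?_
    rintro g ⟨⟨d, hd⟩, hg⟩
    exact (forall_vanishesAt_iff hd).1 hg x hx
  exact hle hf

theorem eval_single_eq_zero (hv : IsClutterType v) {f : MvPolynomial (Fin s) K}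
    (hf : f ∈ projVanishingIdeal (parameterizedSet K v)) (i : Fin s) :
    MvPolynomial.eval (Pi.single i 1) f = 0 := by
  obtain ⟨x, hx⟩ := exists_monomialPoint_eq_single (K := K) hv i
  rw [← hx]
  refine eval_eq_zero_of_mem_projVanishingIdeal hf fun h => ?_
  rw [h] at hx
  simpa using congrFun hx i

theorem X_mul_X_pow_card_sub_mem [Fintype K] (i k : Fin s) :
    X k * X i ^ Fintype.card K - X k ^ Fintype.card K * X i
      ∈ projVanishingIdeal (parameterizedSet K v) := by
  refine mem_projVanishingIdeal (d := 1 + Fintype.card K)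
    (.sub ((MvPolynomial.isHomogeneous_X _ _).mul (MvPolynomial.isHomogeneous_X_pow _ _)) ?_) ?_
  · rw [add_comm]
    exact (MvPolynomial.isHomogeneous_X_pow _ _).mul (MvPolynomial.isHomogeneous_X _ _)
  · intro x
    simp [FiniteField.pow_card]

/-- A homogeneous polynomial in the vanishing ideal also vanishes at the parameterized points that
are zero: in positive degree by homogeneity, and in degree `0` because it is zero. -/
theorem eval_eq_zero_of_isHomogeneous (hs : 1 ≤ s) {f : MvPolynomial (Fin s) K} {d : ℕ}
    (hf : f.IsHomogeneous d) (h : ∀ x : Fin n → K, monomialPoint v x ≠ 0 →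
      MvPolynomial.eval (monomialPoint v x) f = 0) (x : Fin n → K) :
    MvPolynomial.eval (monomialPoint v x) f = 0 := by
  by_cases hx : monomialPoint v x = 0
  · rcases Nat.eq_zero_or_pos d with rfl | hd
    · have h1 := h 1 (by
        rw [monomialPoint_one]
        intro h
        exact one_ne_zero (congrFun h ⟨0, hs⟩))
      have hC := MvPolynomial.totalDegree_eq_zero_iff_eq_C.1
        ((MvPolynomial.totalDegree_zero_iff_isHomogeneous _).2 hf)
      rw [hC, MvPolynomial.eval_C] at h1 ⊢
      exact h1
    · have := hf.eval_smul_eq 0 (monomialPoint v x)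
      rwa [zero_smul, zero_pow hd.ne', zero_mul, ← hx] at this
  · exact h x hx

/-! ### Binomial generators -/

/-- The character of the monoid `K^n` that sends `x` to the value of `t^a` at the point
parameterized by `x`. -/
noncomputable def monomialCharacter (K : Type*) [Field K] {s n : ℕ} (v : Fin s → (Fin n →₀ ℕ))
    (a : Fin s →₀ ℕ) : (Fin n → K) →* K where
  toFun x := MvPolynomial.eval (monomialPoint v x) (MvPolynomial.monomial a 1)
  map_one' := by simp [monomialPoint_one, MvPolynomial.eval_monomial]
  map_mul' x y := by
    simp only [MvPolynomial.eval_monomial, one_mul, Finsupp.prod, ← Finset.prod_mul_distrib,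
      ← mul_pow]
    refine Finset.prod_congr rfl fun i _ => ?_
    simp only [monomialPoint, monomialValue, Pi.mul_apply, mul_pow, Finset.prod_mul_distrib]

/-- The homogeneous binomials `t^a - t^b` in the vanishing ideal. -/
def vanishingBinomials (K : Type*) [Field K] {s n : ℕ} (v : Fin s → (Fin n →₀ ℕ)) :
    Set (MvPolynomial (Fin s) K) :=
  {f | f ∈ projVanishingIdeal (parameterizedSet K v) ∧ ∃ a b : Fin s →₀ ℕ, a.degree = b.degree ∧
    f = MvPolynomial.monomial a 1 - MvPolynomial.monomial b 1}

/-- The vanishing ideal is generated by homogeneous binomials. If a form `∑ c_a t^a` vanishes at all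
parameterized points, then `∑ c_a χ_a = 0` for the characters `χ_a` of `K^n`. As distinct characters
are linearly independent, the coefficients `c_a` add up to zero over each class of exponents with
the same character, so the form is a combination of differences of monomials in the same class. -/
theorem span_vanishingBinomials (hs : 1 ≤ s) :
    Ideal.span (vanishingBinomials K v) = projVanishingIdeal (parameterizedSet K v) := by
  classical
  refine le_antisymm (Ideal.span_le.2 fun f hf => hf.1) (Ideal.span_le.2 ?_)
  rintro f ⟨⟨d, hd⟩, hf⟩
  have hf0 := eval_eq_zero_of_isHomogeneous hs hd ((forall_vanishesAt_iff hd).1 hf)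
  let χ := monomialCharacter K v
  -- a representative of the class of each character that occurs
  have hrep : ∀ ψ : (Fin n → K) →* K, ∃ b : Fin s →₀ ℕ,
      ψ ∈ f.support.image χ → b ∈ f.support ∧ χ b = ψ := by
    intro ψ
    by_cases hψ : ψ ∈ f.support.image χ
    · obtain ⟨b, hb⟩ := Finset.mem_image.1 hψ
      exact ⟨b, fun _ => hb⟩
    · exact ⟨0, fun h => absurd h hψ⟩
  choose rep hrep using hrep
  have hclass : ∀ ψ ∈ f.support.image χ, ∑ a ∈ f.support with χ a = ψ, f.coeff a = 0 := by
    refine linearIndependent_iff'.1 (linearIndependent_monoidHom (Fin n → K) K)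
      (f.support.image χ) (fun ψ => ∑ a ∈ f.support with χ a = ψ, f.coeff a) ?_
    ext x
    rw [Finset.sum_apply, Pi.zero_apply, ← hf0 x]
    conv_rhs => rw [f.as_sum, map_sum]
    rw [← Finset.sum_fiberwise_of_maps_to (t := f.support.image χ) (g := χ)
      fun a ha => Finset.mem_image_of_mem χ ha]
    refine Finset.sum_congr rfl fun ψ _ => ?_
    rw [Pi.smul_apply, smul_eq_mul, Finset.sum_mul]
    refine Finset.sum_congr rfl fun a ha => ?_
    rw [← (Finset.mem_filter.1 ha).2]
    change f.coeff a * MvPolynomial.eval (monomialPoint v x) (MvPolynomial.monomial a 1) = _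
    rw [MvPolynomial.eval_monomial, MvPolynomial.eval_monomial, one_mul]
  have hsum : f = ∑ a ∈ f.support, MvPolynomial.C (f.coeff a) *
      (MvPolynomial.monomial a 1 - MvPolynomial.monomial (rep (χ a)) 1) := by
    have hzero : ∑ a ∈ f.support, MvPolynomial.C (f.coeff a) *
        MvPolynomial.monomial (rep (χ a)) (1 : K) = 0 := by
      rw [← Finset.sum_fiberwise_of_maps_to (t := f.support.image χ) (g := χ)
        fun a ha => Finset.mem_image_of_mem χ ha]
      refine Finset.sum_eq_zero fun ψ hψ => ?_
      rw [Finset.sum_congr rfl (g := fun a => MvPolynomial.C (f.coeff a) *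
          MvPolynomial.monomial (rep ψ) (1 : K)) fun a ha => by rw [(Finset.mem_filter.1 ha).2],
        ← Finset.sum_mul, ← map_sum, hclass ψ hψ, map_zero, zero_mul]
    simp_rw [mul_sub, Finset.sum_sub_distrib]
    rw [hzero, sub_zero]
    simp_rw [MvPolynomial.C_mul_monomial, mul_one]
    exact f.as_sum
  rw [hsum]
  refine sum_mem fun a ha => Ideal.mul_mem_left _ _ (Ideal.subset_span ?_)
  obtain ⟨hb, hχ⟩ := hrep (χ a) (Finset.mem_image_of_mem χ ha)
  have hda : a.degree = d := (hd.degree_eq_sum_deg_support ha).symm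
  have hdb : (rep (χ a)).degree = d := (hd.degree_eq_sum_deg_support hb).symm
  refine ⟨mem_projVanishingIdeal (d := d) (.sub (MvPolynomial.isHomogeneous_monomial _ hda)
    (MvPolynomial.isHomogeneous_monomial _ hdb)) fun x => ?_, a, _, hda.trans hdb.symm, rfl⟩
  rw [map_sub, sub_eq_zero]
  exact (DFunLike.congr_fun hχ x).symm

/-! ### The height of the vanishing ideal -/

/-- The vanishing ideal of a set parameterized by a clutter of `s` monomials has height `s - 1`. -/
theorem height_projVanishingIdeal [Fintype K] (hs : 1 ≤ s) (hv : IsClutterType v) :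
    (projVanishingIdeal (parameterizedSet K v)).height = ((s - 1 : ℕ) : ℕ∞) := by
  classical
  refine le_antisymm ?_ ?_
  · have h := height_le_card_sub_one (⟨0, hs⟩ : Fin s)
      (projVanishingIdeal (parameterizedSet K v)) ?_
    · rwa [Fintype.card_fin] at h
    refine Ideal.span_le.2 ?_
    rintro f ⟨⟨d, hd⟩, hf⟩
    have hfI : f ∈ projVanishingIdeal (parameterizedSet K v) := Ideal.subset_span ⟨⟨d, hd⟩, hf⟩
    refine MvPolynomial.mem_ideal_span_X_image.2 fun m hm => ?_
    by_contra! hcon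
    -- if `m` is a pure power of the first variable, it is the only one of its degree
    have hme : ∀ a ∈ f.support, (∀ k, k ≠ ⟨0, hs⟩ → a k = 0) → a = m := by
      intro a ha h0
      have hdeg : a.degree = m.degree :=
        (hd.degree_eq_sum_deg_support ha).symm.trans (hd.degree_eq_sum_deg_support hm)
      rw [Finsupp.degree_eq_sum, Finsupp.degree_eq_sum,
        Fintype.sum_eq_single _ h0, Fintype.sum_eq_single _ hcon] at hdeg
      ext k
      by_cases hk : k = ⟨0, hs⟩
      · rw [hk, hdeg]
      · rw [h0 k hk, hcon k hk]
    -- so the value at the first coordinate point is the coefficient of `m`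
    have h0 := eval_single_eq_zero hv hfI ⟨0, hs⟩
    rw [MvPolynomial.eval_eq', Finset.sum_eq_single m] at h0
    · rw [Finset.prod_eq_one, mul_one] at h0
      · exact MvPolynomial.mem_support_iff.1 hm h0
      · intro k _
        by_cases hk : k = ⟨0, hs⟩
        · simp [hk]
        · simp [hcon k hk]
    · intro a ha hne
      obtain ⟨k, hk, hak⟩ : ∃ k, k ≠ ⟨0, hs⟩ ∧ a k ≠ 0 := by
        by_contra! h
        exact hne (hme a ha h)
      rw [Finset.prod_eq_zero (Finset.mem_univ k), mul_zero]
      rw [Pi.single_eq_of_ne hk, zero_pow hak]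
    · exact fun h => absurd hm h
  · simpa using card_sub_one_le_height (projVanishingIdeal (parameterizedSet K v))
      fun i k => X_mul_X_pow_card_sub_mem i k

/-! ### Gradients at the coordinate points -/

/-- The row of partial derivatives `(∂f/∂t_k)_{k ≠ i}` at the `i`-th coordinate point. -/
noncomputable def coordinateGradient (K : Type*) [Field K] {s : ℕ} (i : Fin s) :
    MvPolynomial (Fin s) K →ₗ[K] ({k : Fin s // k ≠ i} → K) :=
  LinearMap.pi fun k => (MvPolynomial.aeval (Pi.single i (1 : K))).toLinearMap ∘ₗ
    (MvPolynomial.pderiv (R := K) k.1).toLinearMap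

theorem coordinateGradient_apply (i : Fin s) (f : MvPolynomial (Fin s) K)
    (k : {k : Fin s // k ≠ i}) :
    coordinateGradient K i f k
      = MvPolynomial.eval (Pi.single i 1) (MvPolynomial.pderiv k.1 f) := by
  simp [coordinateGradient, MvPolynomial.aeval_eq_eval]

theorem coordinateGradient_mul (i : Fin s) (p f : MvPolynomial (Fin s) K)
    (hf : MvPolynomial.eval (Pi.single i 1) f = 0) :
    coordinateGradient K i (p * f)
      = MvPolynomial.eval (Pi.single i 1) p • coordinateGradient K i f := by
  ext k
  simp [coordinateGradient_apply, hf]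

/-- The partial derivative in direction `t_k` at the `i`-th coordinate point sees in a monomial only
`t_k t_i ^ m`. -/
theorem exists_eq_single_add_single {i k : Fin s} (hk : k ≠ i) {a : Fin s →₀ ℕ}
    (h : MvPolynomial.eval (Pi.single i (1 : K)) (MvPolynomial.pderiv k (MvPolynomial.monomial a 1))
      ≠ 0) : ∃ m, a = Finsupp.single k 1 + Finsupp.single i m := by
  rw [MvPolynomial.pderiv_monomial, MvPolynomial.eval_monomial] at h
  have hak : a k ≠ 0 := by
    intro h0
    rw [h0] at h
    simp at h
  have hprod := right_ne_zero_of_mul h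
  have hzero : ∀ l, l ≠ i → (a - Finsupp.single k 1 : Fin s →₀ ℕ) l = 0 := by
    intro l hl
    by_contra hne
    refine hprod (Finset.prod_eq_zero (Finsupp.mem_support_iff.2 hne) ?_)
    simp only [Pi.single_eq_of_ne hl]
    exact zero_pow hne
  refine ⟨a i, Finsupp.ext fun l => ?_⟩
  have := hzero l
  simp only [Finsupp.tsub_apply, Finsupp.add_apply, Finsupp.single_apply] at this ⊢
  rcases eq_or_ne l i with rfl | hl
  · simp [hk]
  · have := this hl
    rcases eq_or_ne k l with rfl | hkl
    · simp [hl.symm] at this ⊢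
      omega
    · simp [hl.symm, hkl] at this ⊢
      omega

/-- The gradients at a coordinate point of the elements of the vanishing ideal form the whole space:
already those of `t_k t_i ^ q - t_k ^ q t_i` are the unit vectors. -/
theorem map_coordinateGradient_eq_top [Fintype K] (i : Fin s) :
    Submodule.map (coordinateGradient K i)
      ((projVanishingIdeal (parameterizedSet K v)).restrictScalars K) = ⊤ := by
  classical
  rw [eq_top_iff, ← (Pi.basisFun K {k : Fin s // k ≠ i}).span_eq]
  refine Submodule.span_le.2 ?_
  rintro _ ⟨k, rfl⟩
  refine ⟨_, X_mul_X_pow_card_sub_mem (v := v) i k.1, ?_⟩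
  ext l
  have hq : Fintype.card K - 1 ≠ 0 := Nat.sub_ne_zero_of_lt Fintype.one_lt_card
  rw [coordinateGradient_apply]
  rcases eq_or_ne k l with rfl | hkl
  · simp [k.2, hq]
  · have hil : i ≠ l := l.2.symm
    simp [Subtype.coe_ne_coe.2 hkl, hkl, hil]

/-- The gradients of generators at a coordinate point span, because they do so for all elements of
the vanishing ideal. If there are at most `s - 1` generators, then they form a basis. -/
theorem linearIndependent_coordinateGradient [Fintype K] (hv : IsClutterType v) {m : ℕ}
    (hm : m ≤ s - 1) (g : Fin m → MvPolynomial (Fin s) K)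
    (hg : projVanishingIdeal (parameterizedSet K v) = Ideal.span (Set.range g)) (i : Fin s) :
    m = s - 1 ∧ LinearIndependent K (coordinateGradient K i ∘ g) := by
  have hspan : ⊤ ≤ Submodule.span K (Set.range (coordinateGradient K i ∘ g)) := by
    rw [← map_coordinateGradient_eq_top (v := v) i]
    rintro _ ⟨f, hf, rfl⟩
    replace hf : f ∈ Ideal.span (Set.range g) := hg ▸ hf
    induction hf using Submodule.span_induction with
    | mem x hx =>
      obtain ⟨j, rfl⟩ := hx
      exact Submodule.subset_span ⟨j, rfl⟩
    | zero => rw [map_zero]; exact zero_mem _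
    | add x y _ _ hx hy => rw [map_add]; exact add_mem hx hy
    | smul p x hx' hx =>
      rw [smul_eq_mul, coordinateGradient_mul i p x
        (eval_single_eq_zero hv (hg.symm ▸ hx') i)]
      exact Submodule.smul_mem _ _ hx
  have hrank : Module.finrank K ({k : Fin s // k ≠ i} → K) = s - 1 := by
    rw [Module.finrank_fintype_fun_eq_card, Fintype.card_subtype_compl]
    simp
  have hle : s - 1 ≤ m := by
    have h := finrank_range_le_card (R := K) (coordinateGradient K i ∘ g)
    rw [Set.finrank, top_le_iff.1 hspan, finrank_top, hrank, Fintype.card_fin] at h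
    exact h
  have hms := le_antisymm hm hle
  refine ⟨hms, linearIndependent_of_top_le_span_of_card_eq_finrank hspan ?_⟩
  rw [hrank, Fintype.card_fin, hms]

/-- A vanishing ideal that is a complete intersection has a system of `s - 1` generators that are
homogeneous binomials, linearly independent, and of nonzero gradient at every coordinate point. -/
theorem exists_binomial_generators [Fintype K] (hs : 1 ≤ s) (hv : IsClutterType v)
    (h : IsCompleteIntersection (projVanishingIdeal (parameterizedSet K v))) :
    ∃ g : Fin (s - 1) → MvPolynomial (Fin s) K, (∀ j, g j ∈ vanishingBinomials K v) ∧
      projVanishingIdeal (parameterizedSet K v) = Ideal.span (Set.range g) ∧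
      LinearIndependent K g ∧ ∀ i j, coordinateGradient K i (g j) ≠ 0 := by
  obtain ⟨r, f, hf, hr⟩ := h
  rw [height_projVanishingIdeal hs hv, Nat.cast_inj] at hr
  obtain ⟨m, g, hm, hgB, hg⟩ := exists_generators_subset_of_homogeneous (vanishingBinomials K v)
    (by
      rintro _ ⟨-, a, b, hab, rfl⟩
      exact ⟨a.degree, .sub (MvPolynomial.isHomogeneous_monomial _ rfl)
        (MvPolynomial.isHomogeneous_monomial _ hab.symm)⟩)
    f ((span_vanishingBinomials hs).trans hf)
  rw [span_vanishingBinomials hs] at hg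
  have hind := linearIndependent_coordinateGradient hv (hr ▸ hm) g hg
  obtain rfl := (hind ⟨0, hs⟩).1
  exact ⟨g, hgB, hg, (hind ⟨0, hs⟩).2.of_comp, fun i j => (hind i).2.ne_zero j⟩

/-- A binomial `t^a - t^b` in the vanishing ideal with nonzero gradient at every coordinate point
has degree `d + 1` with `d ≥ 1`, and `t_k t_i ^ d` is one of its two monomials for every `i` and
some `k ≠ i`. -/
theorem exists_shape_of_coordinateGradient_ne_zero (hs : 1 ≤ s) (hv : IsClutterType v)
    {f : MvPolynomial (Fin s) K} (hf : f ∈ vanishingBinomials K v)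
    (hgrad : ∀ i, coordinateGradient K i f ≠ 0) :
    ∃ (a b : Fin s →₀ ℕ) (d : ℕ), d ≠ 0 ∧ a ≠ b ∧ a.degree = d + 1 ∧ b.degree = d + 1 ∧
      f = MvPolynomial.monomial a 1 - MvPolynomial.monomial b 1 ∧
      ∀ i, ∃ k, k ≠ i ∧ (a = Finsupp.single k 1 + Finsupp.single i d ∨
        b = Finsupp.single k 1 + Finsupp.single i d) := by
  obtain ⟨hfI, a, b, hab, rfl⟩ := hf
  have hne : a ≠ b := by
    rintro rfl
    exact hgrad ⟨0, hs⟩ (by rw [sub_self, map_zero])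
  have hshape : ∀ i, ∃ k, k ≠ i ∧ ∃ m, a = Finsupp.single k 1 + Finsupp.single i m ∨
      b = Finsupp.single k 1 + Finsupp.single i m := by
    intro i
    obtain ⟨k, hk⟩ := Function.ne_iff.1 (hgrad i)
    rw [coordinateGradient_apply, map_sub, map_sub, Pi.zero_apply] at hk
    refine ⟨k, k.2, ?_⟩
    by_cases ha : MvPolynomial.eval (Pi.single i (1 : K))
        (MvPolynomial.pderiv k.1 (MvPolynomial.monomial a 1)) = 0
    · rw [ha, zero_sub, neg_ne_zero] at hk
      obtain ⟨m, hm⟩ := exists_eq_single_add_single k.2 hk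
      exact ⟨m, Or.inr hm⟩
    · obtain ⟨m, hm⟩ := exists_eq_single_add_single k.2 ha
      exact ⟨m, Or.inl hm⟩
  have hdeg : ∀ (k i : Fin s) (m : ℕ),
      (Finsupp.single k 1 + Finsupp.single i m).degree = m + 1 := fun k i m => by
    rw [map_add, Finsupp.degree_single, Finsupp.degree_single, add_comm]
  have hpos : a.degree ≠ 0 := by
    obtain ⟨k, -, m, hm | hm⟩ := hshape ⟨0, hs⟩
    · rw [hm, hdeg]
      omega
    · rw [hab, hm, hdeg]
      omega
  refine ⟨a, b, a.degree - 1, ?_, hne, by omega, by omega, rfl, fun i => ?_⟩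
  · -- a linear form in the vanishing ideal vanishes at all coordinate points, hence is zero
    intro hd
    have h1 : a.degree = 1 := by omega
    have h1' : b.degree = 1 := hab ▸ h1
    obtain ⟨k, rfl⟩ := (Finsupp.sum_eq_one_iff a).1 h1
    obtain ⟨l, rfl⟩ := (Finsupp.sum_eq_one_iff b).1 h1'
    have h0 := eval_single_eq_zero hv hfI k
    have hkl : l ≠ k := fun h => hne (by rw [h])
    simp [MvPolynomial.eval_monomial, Pi.single_eq_of_ne hkl] at h0
  · obtain ⟨k, hk, m, hm⟩ := hshape i
    refine ⟨k, hk, ?_⟩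
    rcases hm with hm | hm
    · left
      rw [hm, hdeg, Nat.add_sub_cancel]
    · right
      rw [hab, hm, hdeg, Nat.add_sub_cancel]

/-- The exponent of `t_k t_i ^ d` is that of `t_k' t_i' ^ d` with `i ≠ i'` only if the monomial is
`t_i t_i'`. -/
theorem eq_single_add_single_of_ne {i i' k k' : Fin s} {d : ℕ} (hd : d ≠ 0) (hii : i ≠ i')
    (hk : k ≠ i)
    (h : Finsupp.single k 1 + Finsupp.single i d = Finsupp.single k' 1 + Finsupp.single i' d) :
    d = 1 ∧ k = i' ∧ k' = i := by
  have h1 := DFunLike.congr_fun h i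
  have h2 := DFunLike.congr_fun h i'
  simp only [Finsupp.add_apply, Finsupp.single_apply] at h1 h2
  split_ifs at h1 h2 <;> simp_all

/-- In at least three variables, a binomial in the vanishing ideal with nonzero gradient at every
coordinate point has the form `t_k t_i - t_l t_j`, and every variable occurs in it: for two of
three indices the required monomial `t_k t_i ^ d` is the same, which forces `d = 1`. -/
theorem eq_quadratic_of_coordinateGradient_ne_zero (hs : 3 ≤ s) (hv : IsClutterType v)
    {f : MvPolynomial (Fin s) K} (hf : f ∈ vanishingBinomials K v)
    (hgrad : ∀ i, coordinateGradient K i f ≠ 0) :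
    ∃ k i l j : Fin s, k ≠ i ∧ l ≠ j ∧ (∀ x, x = k ∨ x = i ∨ x = l ∨ x = j) ∧
      f = X k * X i - X l * X j := by
  obtain ⟨a, b, d, hd, hne, -, -, rfl, hshape⟩ :=
    exists_shape_of_coordinateGradient_ne_zero (by omega) hv hf hgrad
  let i₀ : Fin s := ⟨0, by omega⟩
  let i₁ : Fin s := ⟨1, by omega⟩
  let i₂ : Fin s := ⟨2, by omega⟩
  have h01 : i₀ ≠ i₁ := by simp [i₀, i₁]
  have h02 : i₀ ≠ i₂ := by simp [i₀, i₂]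
  have h12 : i₁ ≠ i₂ := by simp [i₁, i₂]
  have hd1 : d = 1 := by
    obtain ⟨k₀, hk₀, h₀⟩ := hshape i₀
    obtain ⟨k₁, hk₁, h₁⟩ := hshape i₁
    obtain ⟨k₂, hk₂, h₂⟩ := hshape i₂
    rcases h₀ with h₀ | h₀ <;> rcases h₁ with h₁ | h₁ <;> rcases h₂ with h₂ | h₂ <;>
    first
    | exact (eq_single_add_single_of_ne hd h01 hk₀ (h₀.symm.trans h₁)).1
    | exact (eq_single_add_single_of_ne hd h02 hk₀ (h₀.symm.trans h₂)).1
    | exact (eq_single_add_single_of_ne hd h12 hk₁ (h₁.symm.trans h₂)).1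
  subst hd1
  -- a monomial `t_k t_i` has the required shape only for the indices `i` and `k`
  have hboth : ∀ c : Fin s →₀ ℕ,
      ∃ i, ∀ k, k ≠ i → c ≠ Finsupp.single k 1 + Finsupp.single i 1 := by
    intro c
    by_contra! hcon
    obtain ⟨k₀, hk₀, h₀⟩ := hcon i₀
    obtain ⟨k₁, hk₁, h₁⟩ := hcon i₁
    obtain ⟨k₂, hk₂, h₂⟩ := hcon i₂
    have e1 := (eq_single_add_single_of_ne one_ne_zero h01 hk₀ (h₀.symm.trans h₁)).2.1
    have e2 := (eq_single_add_single_of_ne one_ne_zero h02 hk₀ (h₀.symm.trans h₂)).2.1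
    exact h12 (e1.symm.trans e2)
  obtain ⟨j, hj⟩ := hboth a
  obtain ⟨i, hi⟩ := hboth b
  obtain ⟨l, hlj, hl⟩ := hshape j
  obtain ⟨k, hki, hk⟩ := hshape i
  replace hl := hl.resolve_left (hj l hlj)
  replace hk := hk.resolve_right (hi k hki)
  refine ⟨k, i, l, j, hki, hlj, fun x => ?_, ?_⟩
  · obtain ⟨y, hyx, hy⟩ := hshape x
    by_contra! hx
    rcases hy with hy | hy
    · exact hx.1 (eq_single_add_single_of_ne one_ne_zero hx.2.1.symm hki
        (hk.symm.trans hy)).2.1.symm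
    · exact hx.2.2.1 (eq_single_add_single_of_ne one_ne_zero hx.2.2.2.symm hlj
        (hl.symm.trans hy)).2.1.symm
  · rw [hk, hl]
    simp [X, MvPolynomial.monomial_mul]

end

/-! ### Quadratic binomials in three and four variables -/

/-- Linearly independent generators of an ideal can be replaced by equally many elements whose
linear span contains them. -/
theorem span_range_eq_of_linearIndependent {K A : Type*} [Field K] [CommRing A] [Algebra K A]
    {m : ℕ} {g q : Fin m → A} (hg : LinearIndependent K g)
    (h : ∀ j, g j ∈ Submodule.span K (Set.range q)) :
    Ideal.span (Set.range g) = Ideal.span (Set.range q) := by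
  have hle : Submodule.span K (Set.range g) ≤ Submodule.span K (Set.range q) :=
    Submodule.span_le.2 (by rintro _ ⟨j, rfl⟩; exact h j)
  have hfin : FiniteDimensional K (Submodule.span K (Set.range q)) :=
    FiniteDimensional.span_of_finite K (Set.finite_range q)
  have heq := Submodule.eq_of_le_of_finrank_le hle (by
    rw [finrank_span_eq_card hg]
    exact finrank_range_le_card q)
  refine le_antisymm (Ideal.span_le.2 ?_) (Ideal.span_le.2 ?_)
  · rintro _ ⟨j, rfl⟩
    exact Submodule.span_le_restrictScalars K A _ (h j)
  · rintro _ ⟨j, rfl⟩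
    exact Submodule.span_le_restrictScalars K A _ (heq ▸ Submodule.subset_span ⟨j, rfl⟩)

set_option synthInstance.maxHeartbeats 200000 in
set_option synthInstance.maxSize 1000 in
/-- Two pairs that cover four indices are the two halves of one of the three perfect matchings. -/
theorem fin_four_pairs : ∀ k i l j : Fin 4, k ≠ i → l ≠ j →
    (∀ x, x = k ∨ x = i ∨ x = l ∨ x = j) →
    (s(k, i) = s(0, 1) ∧ s(l, j) = s(2, 3)) ∨ (s(k, i) = s(2, 3) ∧ s(l, j) = s(0, 1)) ∨
    (s(k, i) = s(0, 2) ∧ s(l, j) = s(1, 3)) ∨ (s(k, i) = s(1, 3) ∧ s(l, j) = s(0, 2)) ∨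
    (s(k, i) = s(1, 2) ∧ s(l, j) = s(0, 3)) ∨ (s(k, i) = s(0, 3) ∧ s(l, j) = s(1, 2)) := by
  decide

/-- Two pairs that cover three indices are two different edges of the triangle. -/
theorem fin_three_pairs : ∀ k i l j : Fin 3, k ≠ i → l ≠ j →
    (∀ x, x = k ∨ x = i ∨ x = l ∨ x = j) →
    (s(k, i) = s(0, 1) ∧ s(l, j) = s(1, 2)) ∨ (s(k, i) = s(1, 2) ∧ s(l, j) = s(0, 1)) ∨
    (s(k, i) = s(0, 2) ∧ s(l, j) = s(1, 2)) ∨ (s(k, i) = s(1, 2) ∧ s(l, j) = s(0, 2)) ∨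
    (s(k, i) = s(0, 1) ∧ s(l, j) = s(0, 2)) ∨ (s(k, i) = s(0, 2) ∧ s(l, j) = s(0, 1)) := by
  decide

theorem X_mul_X_eq_of_sym2_eq {σ R : Type*} [CommRing R] {k i l j : σ} (h : s(k, i) = s(l, j)) :
    (X k * X i : MvPolynomial σ R) = X l * X j := by
  rcases Sym2.eq_iff.1 h with ⟨rfl, rfl⟩ | ⟨rfl, rfl⟩
  · rfl
  · exact mul_comm _ _

/-- The differences of the products over the three perfect matchings of four variables. -/
noncomputable def quadrics₄ (K : Type*) [Field K] : Fin 3 → MvPolynomial (Fin 4) K :=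
  ![X 0 * X 1 - X 2 * X 3, X 0 * X 2 - X 1 * X 3, X 1 * X 2 - X 0 * X 3]

/-- Two independent differences of the three products of two out of three variables. -/
noncomputable def quadrics₃ (K : Type*) [Field K] : Fin 2 → MvPolynomial (Fin 3) K :=
  ![X 0 * X 1 - X 1 * X 2, X 0 * X 2 - X 1 * X 2]

theorem mem_span_quadrics₄ {K : Type*} [Field K] {k i l j : Fin 4} (hki : k ≠ i) (hlj : l ≠ j)
    (h : ∀ x, x = k ∨ x = i ∨ x = l ∨ x = j) :
    (X k * X i - X l * X j : MvPolynomial (Fin 4) K)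
      ∈ Submodule.span K (Set.range (quadrics₄ K)) := by
  have h0 : X 0 * X 1 - X 2 * X 3 ∈ Submodule.span K (Set.range (quadrics₄ K)) :=
    Submodule.subset_span ⟨0, rfl⟩
  have h1 : X 0 * X 2 - X 1 * X 3 ∈ Submodule.span K (Set.range (quadrics₄ K)) :=
    Submodule.subset_span ⟨1, rfl⟩
  have h2 : X 1 * X 2 - X 0 * X 3 ∈ Submodule.span K (Set.range (quadrics₄ K)) :=
    Submodule.subset_span ⟨2, rfl⟩
  rcases fin_four_pairs k i l j hki hlj h with ⟨e, e'⟩ | ⟨e, e'⟩ | ⟨e, e'⟩ | ⟨e, e'⟩ | ⟨e, e'⟩ |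
    ⟨e, e'⟩ <;> rw [X_mul_X_eq_of_sym2_eq e, X_mul_X_eq_of_sym2_eq e']
  · exact h0
  · simpa using neg_mem h0
  · exact h1
  · simpa using neg_mem h1
  · exact h2
  · simpa using neg_mem h2

theorem mem_span_quadrics₃ {K : Type*} [Field K] {k i l j : Fin 3} (hki : k ≠ i) (hlj : l ≠ j)
    (h : ∀ x, x = k ∨ x = i ∨ x = l ∨ x = j) :
    (X k * X i - X l * X j : MvPolynomial (Fin 3) K)
      ∈ Submodule.span K (Set.range (quadrics₃ K)) := by
  have h0 : X 0 * X 1 - X 1 * X 2 ∈ Submodule.span K (Set.range (quadrics₃ K)) :=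
    Submodule.subset_span ⟨0, rfl⟩
  have h1 : X 0 * X 2 - X 1 * X 2 ∈ Submodule.span K (Set.range (quadrics₃ K)) :=
    Submodule.subset_span ⟨1, rfl⟩
  rcases fin_three_pairs k i l j hki hlj h with ⟨e, e'⟩ | ⟨e, e'⟩ | ⟨e, e'⟩ | ⟨e, e'⟩ | ⟨e, e'⟩ |
    ⟨e, e'⟩ <;> rw [X_mul_X_eq_of_sym2_eq e, X_mul_X_eq_of_sym2_eq e']
  · exact h0
  · simpa using neg_mem h0
  · exact h1
  · simpa using neg_mem h1
  · simpa using sub_mem h0 h1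
  · simpa using sub_mem h1 h0

section

variable {K : Type*} [Field K] {s n : ℕ} {v : Fin s → (Fin n →₀ ℕ)}

/-- In more than four variables there is no complete intersection, because a quadratic binomial
involves at most four variables. -/
theorem le_four_of_isCompleteIntersection [Fintype K] (hv : IsClutterType v)
    (h : IsCompleteIntersection (projVanishingIdeal (parameterizedSet K v))) : s ≤ 4 := by
  by_contra! hs
  obtain ⟨g, hgB, -, -, hgrad⟩ := exists_binomial_generators (by omega) hv h
  obtain ⟨k, i, l, j, -, -, hall, -⟩ := eq_quadratic_of_coordinateGradient_ne_zero (by omega) hv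
    (hgB ⟨0, by omega⟩) fun i => hgrad i _
  have hcard : (Finset.univ : Finset (Fin s)).card ≤ ({k, i, l, j} : Finset (Fin s)).card :=
    Finset.card_le_card fun x _ => by simpa using hall x
  rw [Finset.card_univ, Fintype.card_fin] at hcard
  exact absurd (hcard.trans Finset.card_le_four) (by omega)

theorem eq_span_quadrics₄ [Fintype K] {v : Fin 4 → (Fin n →₀ ℕ)} (hv : IsClutterType v)
    (h : IsCompleteIntersection (projVanishingIdeal (parameterizedSet K v))) :
    projVanishingIdeal (parameterizedSet K v) = Ideal.span (Set.range (quadrics₄ K)) := by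
  obtain ⟨g, hgB, hg, hind, hgrad⟩ := exists_binomial_generators (by omega) hv h
  refine hg.trans (span_range_eq_of_linearIndependent hind fun c => ?_)
  obtain ⟨k, i, l, j, hki, hlj, hall, hc⟩ := eq_quadratic_of_coordinateGradient_ne_zero (by omega)
    hv (hgB c) fun i => hgrad i _
  rw [hc]
  exact mem_span_quadrics₄ hki hlj hall

theorem eq_span_quadrics₃ [Fintype K] {v : Fin 3 → (Fin n →₀ ℕ)} (hv : IsClutterType v)
    (h : IsCompleteIntersection (projVanishingIdeal (parameterizedSet K v))) :
    projVanishingIdeal (parameterizedSet K v) = Ideal.span (Set.range (quadrics₃ K)) := by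
  obtain ⟨g, hgB, hg, hind, hgrad⟩ := exists_binomial_generators (by omega) hv h
  refine hg.trans (span_range_eq_of_linearIndependent hind fun c => ?_)
  obtain ⟨k, i, l, j, hki, hlj, hall, hc⟩ := eq_quadratic_of_coordinateGradient_ne_zero (by omega)
    hv (hgB c) fun i => hgrad i _
  rw [hc]
  exact mem_span_quadrics₃ hki hlj hall

/-- In characteristic two the ideal of the quadrics in four variables is not a vanishing ideal: at
its common zeros `t_1 t_2 = t_1 t_3`, because the squares agree, but `t_1 t_2 - t_1 t_3` is not in
the ideal, as the tangent vector `(0, 1, 0, 1)` at the point `(1, 1, 1, 1)` shows. -/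
theorem odd_card_of_eq_span_quadrics₄ [Fintype K] {v : Fin 4 → (Fin n →₀ ℕ)}
    (h : projVanishingIdeal (parameterizedSet K v) = Ideal.span (Set.range (quadrics₄ K))) :
    Odd (Fintype.card K) := by
  rw [← Nat.not_even_iff_odd, Nat.even_iff, ← FiniteField.even_card_iff_char_two]
  intro hchar
  have : CharP K 2 := ringChar.of_eq hchar
  have hmem : (X 0 * X 1 - X 0 * X 2 : MvPolynomial (Fin 4) K)
      ∈ projVanishingIdeal (parameterizedSet K v) := by
    refine mem_projVanishingIdeal (d := 2)
      (.sub ((MvPolynomial.isHomogeneous_X _ _).mul (MvPolynomial.isHomogeneous_X _ _))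
        ((MvPolynomial.isHomogeneous_X _ _).mul (MvPolynomial.isHomogeneous_X _ _))) fun x => ?_
    set w := monomialPoint v x with hw
    by_cases hw0 : w = 0
    · simp [hw0]
    have hz : ∀ j, MvPolynomial.eval w (quadrics₄ K j) = 0 := fun j =>
      eval_eq_zero_of_mem_projVanishingIdeal (h ▸ Ideal.subset_span ⟨j, rfl⟩) hw0
    have e0 : w 0 * w 1 - w 2 * w 3 = 0 := by simpa [quadrics₄] using hz 0
    have e1 : w 0 * w 2 - w 1 * w 3 = 0 := by simpa [quadrics₄] using hz 1
    have h2 : (2 : K) = 0 := CharTwo.two_eq_zero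
    have hsq : (w 0 * w 1 - w 0 * w 2) ^ 2 = 0 := by
      linear_combination w 0 * w 1 * e0 - w 0 * w 2 * e1 +
        (w 0 * w 0 * w 2 * w 2 - w 0 * w 0 * w 1 * w 2) * h2
    simpa using pow_eq_zero_iff two_ne_zero |>.1 hsq
  rw [h] at hmem
  let ε : DualNumber K := DualNumber.eps
  have hε : ε * ε = 0 := DualNumber.eps_mul_eps
  have h2 : (2 : DualNumber K) = 0 := by
    rw [← map_ofNat (algebraMap K (DualNumber K)) 2, CharTwo.two_eq_zero, map_zero]
  let φ : MvPolynomial (Fin 4) K →ₐ[K] DualNumber K := MvPolynomial.aeval ![1, 1 + ε, 1, 1 + ε]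
  have hle : Ideal.span (Set.range (quadrics₄ K)) ≤ RingHom.ker φ := by
    refine Ideal.span_le.2 ?_
    rintro _ ⟨j, rfl⟩
    rw [SetLike.mem_coe, RingHom.mem_ker]
    fin_cases j
    · simp [φ, quadrics₄]
    · simp [φ, quadrics₄]
      linear_combination -hε - ε * h2
    · simp [φ, quadrics₄]
  have h3 := hle hmem
  rw [RingHom.mem_ker] at h3
  have h4 : ε = 0 := by simpa [φ] using h3
  have h5 := congrArg TrivSqZeroExt.snd h4
  simp [ε] at h5

/-- In two variables, if the first monomial of a binomial in the vanishing ideal involves both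
variables, then so does the second one, as the values at the coordinate points show. -/
theorem apply_ne_zero_of_binomial_mem {v : Fin 2 → (Fin n →₀ ℕ)} (hv : IsClutterType v)
    {a b : Fin 2 →₀ ℕ} (hf : MvPolynomial.monomial a 1 - MvPolynomial.monomial b 1 ∈
      projVanishingIdeal (parameterizedSet K v)) (ha : ∀ i, a i ≠ 0) (i : Fin 2) : b i ≠ 0 := by
  intro hb
  have h01 : ∀ j : Fin 2, j ≠ i → ∀ c : Fin 2 →₀ ℕ,
      MvPolynomial.eval (Pi.single j (1 : K)) (MvPolynomial.monomial c 1) = 0 ^ c i := by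
    intro j hj c
    rw [MvPolynomial.eval_monomial, one_mul, Finsupp.prod_fintype _ _ (by simp)]
    rw [Fintype.prod_eq_mul j i hj fun x hx => by omega]
    simp [Pi.single_eq_of_ne hj.symm]
  obtain ⟨j, hj⟩ := exists_ne i
  have h0 := eval_single_eq_zero hv hf j
  rw [map_sub, h01 j hj, h01 j hj, zero_pow (ha i), hb] at h0
  simp at h0

/-- In two variables, the generator has the monomials `t_1 ^ d t_2` and `t_1 t_2 ^ d` required by
the gradients at the two coordinate points; they are different, so `d ≥ 2`. -/
theorem exists_eq_span_of_two [Fintype K] {v : Fin 2 → (Fin n →₀ ℕ)} (hv : IsClutterType v)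
    (h : IsCompleteIntersection (projVanishingIdeal (parameterizedSet K v))) :
    ∃ r : ℕ, r ≠ 0 ∧ projVanishingIdeal (parameterizedSet K v) =
      Ideal.span {X 0 ^ (r + 1) * X 1 - X 0 * X 1 ^ (r + 1)} := by
  obtain ⟨g, hgB, hg, -, hgrad⟩ := exists_binomial_generators (by omega) hv h
  obtain ⟨a, b, d, hd, hne, hda, hdb, hab, hshape⟩ :=
    exists_shape_of_coordinateGradient_ne_zero (by omega) hv (hgB 0) fun i => hgrad i 0
  have hrange : Set.range g = {g 0} := Set.range_unique (ι := Fin 1)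
  rw [hrange] at hg
  have hdeg : ∀ c : Fin 2 →₀ ℕ, c.degree = c 0 + c 1 := fun c => by
    rw [Finsupp.degree_eq_sum, Fin.sum_univ_two]
  have hfI := (hgB 0).1
  rw [hab] at hfI
  have hfI' : MvPolynomial.monomial b (1 : K) - MvPolynomial.monomial a 1 ∈
      projVanishingIdeal (parameterizedSet K v) := by simpa using neg_mem hfI
  -- a monomial that is both `t_2 t_1 ^ d` and `t_1 t_2 ^ d` is `t_1 t_2`, and then so is the other
  have hnot : ∀ {a b : Fin 2 →₀ ℕ}, MvPolynomial.monomial a (1 : K) - MvPolynomial.monomial b 1 ∈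
      projVanishingIdeal (parameterizedSet K v) → b.degree = d + 1 → a ≠ b →
      a = Finsupp.single 1 1 + Finsupp.single 0 d →
      a ≠ Finsupp.single 0 1 + Finsupp.single 1 d := by
    intro a b hf hdb hne h0 h1
    obtain ⟨rfl, -, -⟩ := eq_single_add_single_of_ne hd (by decide) (by decide) (h0.symm.trans h1)
    have hb := apply_ne_zero_of_binomial_mem hv hf (fun i => by fin_cases i <;> simp [h0])
    have hb0 := hb 0
    have hb1 := hb 1
    rw [hdeg] at hdb
    refine hne (Finsupp.ext fun i => ?_)
    fin_cases i
    · simp [h0]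
      omega
    · simp [h0]
      omega
  obtain ⟨k, hk, h0⟩ := hshape 0
  obtain rfl : k = 1 := by omega
  obtain ⟨k, hk', h1⟩ := hshape 1
  obtain rfl : k = 0 := by omega
  have hd1 : d ≠ 1 := by
    rintro rfl
    rw [add_comm (Finsupp.single 0 1)] at h1
    rcases h0 with h0 | h0 <;> rcases h1 with h1 | h1
    · exact hnot hfI hdb hne h0 (h0.trans (add_comm _ _))
    · exact hne (h0.trans h1.symm)
    · exact hne (h1.trans h0.symm)
    · exact hnot hfI' hda hne.symm h0 (h0.trans (add_comm _ _))
  refine ⟨d - 1, by omega, ?_⟩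
  rw [Nat.sub_add_cancel (by omega), hg, hab]
  have hX : ∀ k i : Fin 2, MvPolynomial.monomial (Finsupp.single k 1 + Finsupp.single i d) (1 : K)
      = X k * X i ^ d := fun k i => by
    rw [MvPolynomial.X_pow_eq_monomial, X, MvPolynomial.monomial_mul, one_mul]
  rcases h0 with h0 | h0 <;> rcases h1 with h1 | h1
  · exact absurd h1 (hnot hfI hdb hne h0)
  · rw [h0, h1, hX, hX, mul_comm (X 1)]
  · rw [h0, h1, hX, hX, ← Ideal.span_singleton_neg, neg_sub, mul_comm (X 1)]
  · exact absurd h1 (hnot hfI' hda hne.symm h0)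

/-- The exponent of the generator in two variables divides `q - 1`: in the group algebra of
`ℤ / r`, at `t_1 = ζ`, `t_2 = 1` for the canonical generator `ζ`, the generator vanishes, and hence
so does the polynomial `t_1 t_2 ^ q - t_1 ^ q t_2`. -/
theorem dvd_card_sub_one_of_eq_span [Fintype K] {v : Fin 2 → (Fin n →₀ ℕ)} {r : ℕ}
    (h : projVanishingIdeal (parameterizedSet K v) =
      Ideal.span {X 0 ^ (r + 1) * X 1 - X 0 * X 1 ^ (r + 1)}) : r ∣ Fintype.card K - 1 := by
  have hmem := X_mul_X_pow_card_sub_mem (K := K) (v := v) 1 0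
  rw [h] at hmem
  let ζ : AddMonoidAlgebra K (ZMod r) := AddMonoidAlgebra.single 1 1
  have hζ : ∀ m : ℕ, ζ ^ m = AddMonoidAlgebra.single (m : ZMod r) 1 := fun m => by
    simp [ζ, AddMonoidAlgebra.single_pow]
  let φ : MvPolynomial (Fin 2) K →ₐ[K] AddMonoidAlgebra K (ZMod r) := MvPolynomial.aeval ![ζ, 1]
  have hle : Ideal.span {X 0 ^ (r + 1) * X 1 - X 0 * X 1 ^ (r + 1)} ≤ RingHom.ker φ := by
    rw [Ideal.span_le, Set.singleton_subset_iff, SetLike.mem_coe, RingHom.mem_ker]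
    simp [φ, hζ, ζ]
  have h0 := hle hmem
  rw [RingHom.mem_ker] at h0
  have h1 : ζ ^ 1 = ζ ^ Fintype.card K := by
    rw [← sub_eq_zero]
    simpa [φ] using h0
  rw [hζ, hζ] at h1
  have h2 : ((1 : ℕ) : ZMod r) = (Fintype.card K : ZMod r) :=
    AddMonoidAlgebra.single_left_injective one_ne_zero h1
  exact (Nat.modEq_iff_dvd' Fintype.card_pos).1 ((ZMod.natCast_eq_natCast_iff _ _ _).1 h2)

end

/-! ### The classification -/

theorem theorem2p11 {K : Type*} [Field K] [Fintype K] {s n : ℕ} (hs : 1 ≤ s)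
    (v : Fin s → (Fin n →₀ ℕ)) (hv : IsClutterType v) :
    IsCompleteIntersection (projVanishingIdeal (parameterizedSet K v)) ↔
      s ≤ 4 ∧
      ((s = 4 ∧ Odd (Fintype.card K) ∧ ∃ e : Fin 4 ≃ Fin s,
          projVanishingIdeal (parameterizedSet K v) =
            Ideal.span {X (e 0) * X (e 1) - X (e 2) * X (e 3),
              X (e 0) * X (e 2) - X (e 1) * X (e 3),
              X (e 1) * X (e 2) - X (e 0) * X (e 3)}) ∨
       (s = 3 ∧ ∃ e : Fin 3 ≃ Fin s,
          projVanishingIdeal (parameterizedSet K v) =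
            Ideal.span {X (e 0) * X (e 1) - X (e 1) * X (e 2),
              X (e 0) * X (e 2) - X (e 1) * X (e 2)}) ∨
       (s = 2 ∧ ∃ r : ℕ, r ≠ 0 ∧ r ∣ Fintype.card K - 1 ∧ ∃ e : Fin 2 ≃ Fin s,
          projVanishingIdeal (parameterizedSet K v) =
            Ideal.span {X (e 0) ^ (r + 1) * X (e 1) - X (e 0) * X (e 1) ^ (r + 1)}) ∨
       (s = 1 ∧ projVanishingIdeal (parameterizedSet K v) = ⊥)) := by
  constructor
  · intro h
    have hs4 := le_four_of_isCompleteIntersection hv h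
    refine ⟨hs4, ?_⟩
    obtain rfl | rfl | rfl | rfl : s = 4 ∨ s = 3 ∨ s = 2 ∨ s = 1 := by omega
    · have hI := eq_span_quadrics₄ hv h
      refine Or.inl ⟨rfl, odd_card_of_eq_span_quadrics₄ hI, Equiv.refl _, hI.trans ?_⟩
      simp only [quadrics₄, Matrix.range_cons _ ![_, _], Matrix.range_cons_cons_empty,
        ← Set.insert_eq, Equiv.refl_apply]
    · refine Or.inr (Or.inl ⟨rfl, Equiv.refl _, (eq_span_quadrics₃ hv h).trans ?_⟩)
      simp only [quadrics₃, Matrix.range_cons_cons_empty, Equiv.refl_apply]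
    · obtain ⟨r, hr, hI⟩ := exists_eq_span_of_two hv h
      exact Or.inr (Or.inr (Or.inl ⟨rfl, r, hr, dvd_card_sub_one_of_eq_span hI, Equiv.refl _, hI⟩))
    · obtain ⟨g, -, hg, -⟩ := exists_binomial_generators hs hv h
      refine Or.inr (Or.inr (Or.inr ⟨rfl, hg.trans ?_⟩))
      have : IsEmpty (Fin (1 - 1)) := Fin.isEmpty'
      rw [Set.range_eq_empty, Ideal.span_empty]
  · have hheight := height_projVanishingIdeal (K := K) hs hv
    rintro ⟨-, ⟨rfl, -, e, hI⟩ | ⟨rfl, e, hI⟩ | ⟨rfl, r, -, -, e, hI⟩ | ⟨rfl, hI⟩⟩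
    · refine ⟨3, ![X (e 0) * X (e 1) - X (e 2) * X (e 3), X (e 0) * X (e 2) - X (e 1) * X (e 3),
        X (e 1) * X (e 2) - X (e 0) * X (e 3)], hI.trans ?_, hheight⟩
      rw [Matrix.range_cons, Matrix.range_cons_cons_empty, ← Set.insert_eq]
    · refine ⟨2, ![X (e 0) * X (e 1) - X (e 1) * X (e 2), X (e 0) * X (e 2) - X (e 1) * X (e 2)],
        hI.trans ?_, hheight⟩
      rw [Matrix.range_cons_cons_empty]
    · refine ⟨1, fun _ => X (e 0) ^ (r + 1) * X (e 1) - X (e 0) * X (e 1) ^ (r + 1),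
        hI.trans ?_, hheight⟩
      rw [Set.range_const]
    · refine ⟨0, Fin.elim0, hI.trans ?_, hheight⟩
      rw [Set.range_eq_empty, Ideal.span_empty]
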